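/- **Definitions.** For $f:\mathbb N\to\mathbb N$ let $f^{(i)}$ denote the $i$-fold composition of $f$ with itself and let $f^*(n)=\min\{i\ge 0: f^{(i)}(n)\le 1\}$. Put $\lambda_1(n)=\lfloor\sqrt n\rfloor$, $\lambda_2(n)=\lceil\log_2 n\rceil$ and $\lambda_d(n)=\lambda_{d-2}^*(n)$ for $d\ge 3$. The inverse Ackermann function is $\alpha(n)=\min\{d\ge 2 : d \text{ even},\ \lambda_d(n)\le 6\}$. A *circuit* with $n$ inputs and $m$ outputs is a finite directed acyclic graph with $n$ input vertices (of in-degree $0$) whose other vertices are gates, together with $m$ distinct vertices designated as outputs; a gate of fan-in $s$ ($s$ is unrestricted) computes an arbitrary Boolean function $\{0,1\}^s\to\{0,1\}$ of the values of its in-neighbours. Its *size* is the number of wires (edges), and its *depth* is the length of a longest directed path from an input to an output. A function $f:\{0,1\}^n\to\{0,1\}^m$ *encodes a code of relative distance $\ge\delta$* if $f(x)$ and $f(y)$ differ in at least $\delta m$ positions for all $x\ne y$. **Theorem 2 (Lower bound).** Let $\rho\in(0,1)$, $\delta\in(0,\tfrac12)$ and $c>0$ be constants. There is an $N=N(\rho,\delta,c)$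 such that for every $n\ge N$, every circuit $C_n:\{0,1\}^n\to\{0,1\}^{\lfloor n/\rho\rfloor}$ of size at most $cn$ that encodes an error-correcting code of relative distance $\ge\delta$ has depth at least $\alpha(n)-2$. -/

import Mathlib

/-! ### The functions `λ_d` and the inverse Ackermann function -/

/-- `f^*(n) = min {i : f^{(i)}(n) ≤ 1}`, where `f^{(i)}` is the `i`-fold composition. -/
noncomputable def iterStar (f : ℕ → ℕ) (n : ℕ) : ℕ :=
  sInf {i : ℕ | f^[i] n ≤ 1}

/-- `λ_1(n) = ⌊√n⌋`, `λ_2(n) = ⌈log₂ n⌉`, and `λ_d = (λ_{d-2})^*` for `d ≥ 3`.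
The index `0` is not used; the value there is a placeholder. -/
noncomputable def lam : ℕ → ℕ → ℕ
  | 0 => id
  | 1 => Nat.sqrt
  | 2 => Nat.clog 2
  | d + 3 => iterStar (lam (d + 1))

/-- `α(n) = min {even d : λ_d(n) ≤ 6}`, the minimum being over the positive even numbers. -/
noncomputable def inverseAckermann (n : ℕ) : ℕ :=
  sInf {d : ℕ | 0 < d ∧ Even d ∧ lam d n ≤ 6}

/-! ### Circuits with arbitrary gates of unbounded fan-in -/

/-- A Boolean circuit with `n` inputs and `m` outputs: a finite directed acyclic graph whose
vertices are the `n` inputs (without incoming wires) and the gates. Each gate `v` computes an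
arbitrary Boolean function `op v` of the values of its in-neighbours `preds v`, whose number is
unrestricted. The `m` outputs are distinct vertices; an output may have outgoing wires. As the set
of gates is finite, well-foundedness of the wires is the absence of directed cycles. -/
structure Circuit (n m : ℕ) where
  /-- the gates, i.e. the vertices that are not inputs -/
  Gate : Type
  [fintypeGate : Fintype Gate]
  /-- the in-neighbours of a gate -/
  preds : Gate → Finset (Fin n ⊕ Gate)
  acyclic : WellFounded (fun u v : Gate => Sum.inr u ∈ preds v)
  /-- the function computed by a gate -/
  op : (v : Gate) → ({u // u ∈ preds v} → Bool) → Bool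
  /-- the output vertices -/
  output : Fin m ↪ (Fin n ⊕ Gate)

namespace Circuit

attribute [instance] Circuit.fintypeGate

variable {n m : ℕ} (C : Circuit n m)

/-- The size of a circuit is its number of wires. -/
def size : ℕ := ∑ v : C.Gate, (C.preds v).card

/-- The value of a gate on the input `x`. -/
noncomputable def gateValue (x : Fin n → Bool) : C.Gate → Bool :=
  C.acyclic.fix fun v ih => C.op v fun u =>
    match u with
    | ⟨Sum.inl i, _⟩ => x i
    | ⟨Sum.inr w, h⟩ => ih w h

/-- The value of a vertex on the input `x`. -/
noncomputable def value (x : Fin n → Bool) : Fin n ⊕ C.Gate → Bool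
  | Sum.inl i => x i
  | Sum.inr v => C.gateValue x v

theorem value_inr (x : Fin n → Bool) (v : C.Gate) :
    C.value x (Sum.inr v) = C.op v fun u => C.value x u := by
  change C.gateValue x v = _
  unfold gateValue
  rw [WellFounded.fix_eq]
  congr 1
  funext u
  rcases u with ⟨i | w, h⟩ <;> rfl

/-- The function `{0,1}^n → {0,1}^m` computed by the circuit. -/
noncomputable def eval (x : Fin n → Bool) : Fin m → Bool :=
  fun j => C.value x (C.output j)

/-- The set of wires of the circuit, as pairs (tail, head). -/
def wires : SetRel (Fin n ⊕ C.Gate) (Fin n ⊕ C.Gate) :=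
  {e | ∃ v : C.Gate, e.2 = Sum.inr v ∧ e.1 ∈ C.preds v}

/-- The lengths (numbers of wires) of the directed paths from an input to an output. -/
def pathLengths : Set ℕ :=
  {k | ∃ p : RelSeries C.wires, p.length = k ∧
    (∃ i, p.head = Sum.inl i) ∧ ∃ j, p.last = C.output j}

/-- The depth of a circuit is the length of a longest directed path from an input to an output. -/
noncomputable def depth : ℕ := sSup C.pathLengths

/-- The path lengths of a circuit are bounded, so the supremum in `depth` is a maximum as soon as
there is a path from an input to an output. -/
theorem bddAbove_pathLengths : BddAbove C.pathLengths := by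
  have key : ∀ (v : C.Gate), ∃ B : ℕ, ∀ p : RelSeries C.wires,
      p.last = Sum.inr v → p.length ≤ B := by
    intro v
    induction v using C.acyclic.induction with
    | _ v ih =>
    choose! B hB using ih
    refine ⟨(∑ w : C.Gate, B w) + 1, fun p hp => ?_⟩
    rcases Nat.eq_zero_or_pos p.length with h0 | h0
    · omega
    have hne : p.length ≠ 0 := h0.ne'
    have hs := p.eraseLast_last_rel_last hne
    obtain ⟨w', hw', hmem⟩ := hs
    simp only [hp, Sum.inr.injEq] at hw'
    subst hw'
    have hlen : p.length = p.eraseLast.length + 1 := by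
      simp only [RelSeries.eraseLast_length]; omega
    rcases hq : p.eraseLast.last with i | w
    · have h1 : p.eraseLast.length = 0 := by
        by_contra hcon
        obtain ⟨z, hz, _⟩ := p.eraseLast.eraseLast_last_rel_last hcon
        simp only [hq] at hz
        cases hz
      omega
    · simp only [hq] at hmem
      have h1 := hB w hmem p.eraseLast hq
      have h2 : B w ≤ ∑ w : C.Gate, B w :=
        Finset.single_le_sum (fun _ _ => Nat.zero_le _) (Finset.mem_univ w)
      omega
  choose B hB using key
  refine ⟨∑ w : C.Gate, B w, ?_⟩
  rintro k ⟨p, rfl, -, -⟩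
  rcases hq : p.last with i | w
  · have h1 : p.length = 0 := by
      by_contra hcon
      obtain ⟨z, hz, _⟩ := p.eraseLast_last_rel_last hcon
      simp only [hq] at hz
      cases hz
    omega
  · exact (hB w p hq).trans
      (Finset.single_le_sum (fun _ _ => Nat.zero_le _) (Finset.mem_univ w))

end Circuit

/-- `f : {0,1}^n → {0,1}^m` encodes a code of relative distance at least `δ`: the codewords of
distinct messages differ in at least `δ m` positions. -/
def EncodesRelDist {n m : ℕ} (δ : ℝ) (f : (Fin n → Bool) → (Fin m → Bool)) : Prop :=
  ∀ x y : Fin n → Bool, x ≠ y → δ * (m : ℝ) ≤ (hammingDist (f x) (f y) : ℝ)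

/-!
A circuit of linear size and very small depth has a sparse cut, and a sparse cut makes two codewords
close.

*Sparse cuts.* Let a graph have at most `r * n` edges and `2 * j + 2` levels of vertices. Then at
some scale `y` between `r` and `cutBound j r` one can delete `n / (r * y)` vertices so that, up to
`n / r` exceptional start vertices and `n / r` exceptional end vertices, at most `n * y / r` pairs
remain connected (`exists_sparse_cut`). The proof is by induction on `j`. Among `4 * r ^ 2` disjoint
windows of vertex degrees there is one that few edges touch. Vertices of degree above the window are
few and are deleted; the neighbours of vertices in the window are declared exceptional; and the
vertices of degree below the window lose little when the lemma is applied, with a larger `r`, to the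
graph without its first and last level.

*Codes.* Apply this to the wires on the paths from inputs to outputs, and let `B` be the deleted set.
By averaging, some `#B + 1` inputs are together connected, outside `B`, to only `O(n / r)` outputs.
By the pigeonhole principle two messages supported on these inputs give the same values on `B`,
hence codewords at distance `O(n / r)` (`Circuit.exists_close_codewords`). For large `r` this is less
than `δ * m`, so the depth of an encoder exceeds `2 * j + 1` whenever `cutBound j r ≤ n`.

*Growth.* Iterating over the windows makes `cutBound` grow like the Ackermann hierarchy. With
`lamInv k` the inverse of `λ_{2 (k + 1)}`, three applications of `lamInv k` bound `cutBound (k + 1)`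
(`cutBound_le`). If `α(n) = 2 k + 6`, then `λ_{2 (k + 2)}(n) > 6`, so `n` exceeds the result of four
applications of `lamInv k` to `4`, and the first of them already exceeds any constant when `k` is
large (`cutBound_lt_of_lam`). Bounded `k` only requires `n` to be large.
-/

/-! ### Sparse cuts in graphs with few levels -/

/-- An upper bound for the scale at which a graph with at most `r * n` edges and at most `2 * j + 1`
levels of edges admits a sparse cut. Each of the `4 * r ^ 2` iterations is one window of vertex
degrees, namely `[t, 4 r² F(4 r² t²))` for `F = cutBound j`; the lower end of the next window is the
upper end of this one. -/
def cutBound : ℕ → ℕ → ℕ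
  | 0, r => r ^ 2
  | j + 1, r => (fun t => 4 * r ^ 2 * cutBound j (4 * r ^ 2 * t ^ 2))^[4 * r ^ 2] r

theorem le_four_mul_sq_mul {r t f : ℕ} (hr : 1 ≤ r) (ht : 1 ≤ t) (hf : 4 * r ^ 2 * t ^ 2 ≤ f) :
    t ≤ 4 * r ^ 2 * f := by
  have h1 : 1 ≤ r ^ 2 := Nat.one_le_pow _ _ hr
  nlinarith [Nat.mul_le_mul h1 ht, Nat.mul_le_mul h1 (Nat.mul_le_mul ht ht)]

theorem mul_le_of_le_add {a b c x n : ℕ} (ha : a * (2 * x) ≤ n) (hb : b * (2 * x) ≤ n)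
    (h : c ≤ a + b) : c * x ≤ n := by
  have := Nat.mul_le_mul_right x h
  linarith

theorem le_iterate_of_le {h : ℕ → ℕ} {r : ℕ} (hh : ∀ t, r ≤ t → t ≤ h t) (i : ℕ) :
    r ≤ h^[i] r := by
  induction i with
  | zero => exact le_rfl
  | succ i ih => rw [Function.iterate_succ_apply']; exact ih.trans (hh _ ih)

theorem le_cutBound (j : ℕ) : ∀ r, 1 ≤ r → r ≤ cutBound j r := by
  induction j with
  | zero => intro r hr; simp only [cutBound]; nlinarith
  | succ j ih =>
    intro r hr
    refine le_iterate_of_le (fun t ht => ?_) _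
    have ht1 := hr.trans ht
    have : 1 ≤ 4 * r ^ 2 * t ^ 2 := Nat.succ_le_of_lt (by positivity)
    exact le_four_mul_sq_mul hr (hr.trans ht) (ih _ this)

open Finset in
/-- Every element lies in at most one of the windows `[τ i, τ (i + 1))`. -/
theorem sum_card_window_le {β : Type*} (s : Finset β) (f : β → ℕ) {τ : ℕ → ℕ} (hτ : Monotone τ)
    (K : ℕ) : ∑ i ∈ range K, #{e ∈ s | τ i ≤ f e ∧ f e < τ (i + 1)} ≤ #s := by
  classical
  rw [← card_biUnion]
  · exact card_le_card fun e he => by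
      simp only [mem_biUnion, mem_filter] at he
      obtain ⟨_, _, he, _⟩ := he
      exact he
  · intro i _ i' _ hne
    rw [Function.onFun, Finset.disjoint_left]
    intro e he he'
    simp only [mem_filter] at he he'
    exact Set.disjoint_left.1 (hτ.pairwise_disjoint_on_Ico_succ hne) ⟨he.2.1, he.2.2⟩
      ⟨he'.2.1, he'.2.2⟩

open Finset in
theorem sum_card_fiber_le {β γ : Type*} [DecidableEq γ] (s : Finset γ) (E : Finset β) (f : β → γ) :
    ∑ v ∈ s, #{e ∈ E | f e = v} ≤ #E := by
  rw [sum_card_fiberwise_eq_card_filter]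
  exact card_filter_le _ _

section Cut

variable {V : Type*} [DecidableEq V]

/-- The adjacency relation of the graph with edge set `E` after deletion of the vertices in `B`. -/
def AdjAvoiding (E : Finset (V × V)) (B : Finset V) (u v : V) : Prop :=
  (u, v) ∈ E ∧ u ∉ B ∧ v ∉ B

/-- The tails of the edges with head `v`. -/
def inNbrs (E : Finset (V × V)) (v : V) : Finset V := (E.filter fun e => e.2 = v).image Prod.fst

/-- The heads of the edges with tail `v`. -/
def outNbrs (E : Finset (V × V)) (v : V) : Finset V := (E.filter fun e => e.1 = v).image Prod.snd

/-- The number of edges, incoming or outgoing, at the vertex `v`. -/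
def totalDegree (E : Finset (V × V)) (v : V) : ℕ :=
  (E.filter fun e => e.2 = v).card + (E.filter fun e => e.1 = v).card

theorem mem_inNbrs {E : Finset (V × V)} {u v : V} : u ∈ inNbrs E v ↔ (u, v) ∈ E := by
  simp [inNbrs]

theorem mem_outNbrs {E : Finset (V × V)} {u v : V} : v ∈ outNbrs E u ↔ (u, v) ∈ E := by
  simp [outNbrs]

theorem card_inNbrs_le (E : Finset (V × V)) (v : V) : (inNbrs E v).card ≤ totalDegree E v :=
  Finset.card_image_le.trans (Nat.le_add_right _ _)

theorem card_outNbrs_le (E : Finset (V × V)) (v : V) : (outNbrs E v).card ≤ totalDegree E v :=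
  Finset.card_image_le.trans (Nat.le_add_left _ _)

theorem exists_finset_totalDegree_ge (E : Finset (V × V)) {T : ℕ} (hT : 1 ≤ T) :
    ∃ H : Finset V, H.card * T ≤ 2 * E.card ∧ ∀ v, T ≤ totalDegree E v → v ∈ H := by
  refine ⟨(E.image Prod.snd ∪ E.image Prod.fst).filter fun v => T ≤ totalDegree E v, ?_, ?_⟩
  · rw [← smul_eq_mul]
    refine (Finset.card_nsmul_le_sum _ (totalDegree E) T fun v hv =>
      (Finset.mem_filter.1 hv).2).trans ?_
    rw [two_mul]
    refine (Finset.sum_add_distrib (f := fun v => (E.filter fun e => e.2 = v).card)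
      (g := fun v => (E.filter fun e => e.1 = v).card)).trans_le ?_
    exact add_le_add (sum_card_fiber_le _ E Prod.snd) (sum_card_fiber_le _ E Prod.fst)
  · intro v hv
    refine Finset.mem_filter.2 ⟨?_, hv⟩
    have h0 : 0 < totalDegree E v := by omega
    rcases Nat.add_pos_iff_pos_or_pos.1 h0 with h | h <;> obtain ⟨e, he⟩ := Finset.card_pos.1 h <;>
      rw [Finset.mem_filter] at he
    · exact Finset.mem_union_left _ (Finset.mem_image.2 ⟨e, he⟩)
    · exact Finset.mem_union_right _ (Finset.mem_image.2 ⟨e, he⟩)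

omit [DecidableEq V] in
/-- A walk between vertices strictly between the levels `a` and `b` only uses edges strictly
between these levels. -/
theorem reflTransGen_inner {E : Finset (V × V)} {B : Finset V} {ℓ : V → ℕ} {a b : ℕ}
    (hE : ∀ e ∈ E, ℓ e.1 < ℓ e.2) {w z : V} (h : Relation.ReflTransGen (AdjAvoiding E B) w z)
    (hw : a < ℓ w) (hz : ℓ z < b) :
    Relation.ReflTransGen (AdjAvoiding (E.filter fun e => a < ℓ e.1 ∧ ℓ e.2 < b) B) w z ∧
      ℓ w ≤ ℓ z := by
  induction h with
  | refl => exact ⟨.refl, le_rfl⟩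
  | @tail y z _ hyz ih =>
    have hlt : ℓ y < ℓ z := hE _ hyz.1
    obtain ⟨h1, h2⟩ := ih (hlt.trans hz)
    exact ⟨h1.tail ⟨Finset.mem_filter.2 ⟨hyz.1, hw.trans_le h2, hz⟩, hyz.2⟩, h2.trans hlt.le⟩

/-- A window of degrees `[t, 4 r² F(4 r² t²))`, where `F = cutBound j`, such that few edges have
an endpoint whose degree lies in it. -/
theorem exists_sparse_window (j r n : ℕ) (E : Finset (V × V)) (hr : 1 ≤ r)
    (hcard : E.card ≤ r * n) :
    ∃ t, r ≤ t ∧ 4 * r ^ 2 * cutBound j (4 * r ^ 2 * t ^ 2) ≤ cutBound (j + 1) r ∧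
      ((E.filter fun e => t ≤ totalDegree E e.2 ∧
          totalDegree E e.2 < 4 * r ^ 2 * cutBound j (4 * r ^ 2 * t ^ 2)).card +
        (E.filter fun e => t ≤ totalDegree E e.1 ∧
          totalDegree E e.1 < 4 * r ^ 2 * cutBound j (4 * r ^ 2 * t ^ 2)).card) * (2 * r) ≤ n := by
  set h : ℕ → ℕ := fun t => 4 * r ^ 2 * cutBound j (4 * r ^ 2 * t ^ 2) with hh
  have hle : ∀ t, r ≤ t → t ≤ h t := fun t ht => by
    have ht1 := hr.trans ht
    exact le_four_mul_sq_mul hr ht1 (le_cutBound j _ (Nat.succ_le_of_lt (by positivity)))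
  have hge : ∀ i, r ≤ h^[i] r := le_iterate_of_le hle
  have hmono : Monotone fun i => h^[i] r := monotone_nat_of_le_succ fun i => by
    rw [Function.iterate_succ_apply']; exact hle _ (hge i)
  have hK : 0 < 4 * r ^ 2 := by positivity
  have hsum := add_le_add
    (sum_card_window_le E (fun e => totalDegree E e.2) hmono (4 * r ^ 2))
    (sum_card_window_le E (fun e => totalDegree E e.1) hmono (4 * r ^ 2))
  rw [← Finset.sum_add_distrib] at hsum
  obtain ⟨i, hi, hmin⟩ := Finset.exists_min_image (Finset.range (4 * r ^ 2)) (fun i =>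
    (E.filter fun e => h^[i] r ≤ totalDegree E e.2 ∧ totalDegree E e.2 < h^[i + 1] r).card +
    (E.filter fun e => h^[i] r ≤ totalDegree E e.1 ∧ totalDegree E e.1 < h^[i + 1] r).card)
    ⟨0, Finset.mem_range.2 hK⟩
  have hb := (Finset.card_nsmul_le_sum _ _ _ hmin).trans hsum
  refine ⟨h^[i] r, hge i, ?_, ?_⟩
  · have := hmono (Nat.succ_le_of_lt (Finset.mem_range.1 hi))
    simp only [Function.iterate_succ_apply'] at this
    exact this
  · simp only [Function.iterate_succ_apply', Finset.card_range, smul_eq_mul] at hb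
    rw [hh] at hb ⊢
    beta_reduce at hb ⊢
    refine Nat.le_of_mul_le_mul_left ?_ (show 0 < 2 * r by omega)
    nlinarith [hb, hcard]

/-- **Sparse cuts.** In a graph with at most `r * n` edges and levels in an interval of length
`2 * j + 1`, there is a scale `y` such that the deletion of `n / (r * y)` vertices leaves at most
`n * y / r` connected pairs, up to `n / r` exceptional start vertices and `n / r` exceptional end
vertices. -/
theorem exists_sparse_cut (j : ℕ) : ∀ (r n a : ℕ) (ℓ : V → ℕ) (E : Finset (V × V)), 1 ≤ r →
    (∀ e ∈ E, a ≤ ℓ e.1 ∧ ℓ e.1 < ℓ e.2 ∧ ℓ e.2 ≤ a + (2 * j + 1)) → E.card ≤ r * n →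
    ∃ (y : ℕ) (B I O : Finset V) (S : Finset (V × V)), r ≤ y ∧ y ≤ cutBound j r ∧
      B.card * (r * y) ≤ n ∧ I.card * r ≤ n ∧ O.card * r ≤ n ∧ S.card * r ≤ n * y ∧
      ∀ u v, Relation.TransGen (AdjAvoiding E B) u v → u ∈ I ∨ v ∈ O ∨ (u, v) ∈ S := by
  induction j with
  | zero =>
    intro r n a ℓ E hr hE hcard
    refine ⟨r ^ 2, ∅, ∅, ∅, E, by nlinarith, le_rfl, by simp, by simp, by simp, by nlinarith, ?_⟩
    intro u v huv
    obtain ⟨w, hw, hwv⟩ := Relation.TransGen.head'_iff.1 huv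
    rcases hwv.cases_head with rfl | ⟨z, hz, -⟩
    · exact Or.inr (Or.inr hw.1)
    · have h1 := hE _ hw.1
      have h2 := hE _ hz.1
      simp only at h1 h2
      omega
  | succ j ih =>
    intro r n a ℓ E hr hE hcard
    obtain ⟨t, hrt, htop, hwin⟩ := exists_sparse_window j r n E hr hcard
    set r' := 4 * r ^ 2 * t ^ 2 with hr'
    set T := 4 * r ^ 2 * cutBound j r' with hT
    have ht : 1 ≤ t := hr.trans hrt
    have hr1 : 1 ≤ r' := Nat.one_le_iff_ne_zero.2 (by positivity)
    have hTpos : 1 ≤ T := by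
      have := hr1.trans (le_cutBound j r' hr1)
      exact Nat.succ_le_of_lt (by positivity)
    have h2rt : 2 * r * t ≤ r' := by
      calc 2 * r * t ≤ 4 * r ^ 2 * t ^ 2 := by
            gcongr
            · norm_num
            · exact Nat.le_self_pow two_ne_zero r
            · exact Nat.le_self_pow two_ne_zero t
        _ = r' := rfl
    have hrr' : r ≤ r' := by nlinarith
    set E' := E.filter fun e => a < ℓ e.1 ∧ ℓ e.2 < a + (2 * (j + 1) + 1) with hE'
    -- The inner graph: without the lowest and the highest level. The parameter `r'` pays for the
    -- factors `t` and `t ^ 2` that are lost when its pairs are extended by vertices of degree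
    -- less than `t`.
    obtain ⟨y, B', I', O', S', hy1, hy2, hB', hI', hO', hS', hpath⟩ := ih r' n (a + 1) ℓ E' hr1
      (by
        intro e he
        obtain ⟨he, h1, h2⟩ := Finset.mem_filter.1 he
        have := hE e he
        omega)
      ((Finset.card_filter_le _ _).trans (hcard.trans (Nat.mul_le_mul_right _ hrr')))
    obtain ⟨H, hHcard, hH⟩ := exists_finset_totalDegree_ge E hTpos
    -- The neighbours of vertices in the window and of exceptional inner vertices become exceptional.
    set I₁ := (E.filter fun e => t ≤ totalDegree E e.2 ∧ totalDegree E e.2 < T).image Prod.fst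
      with hI₁
    set O₁ := (E.filter fun e => t ≤ totalDegree E e.1 ∧ totalDegree E e.1 < T).image Prod.snd
      with hO₁
    set I₂ := (I'.filter fun w => totalDegree E w < t).biUnion (inNbrs E) with hI₂
    set O₂ := (O'.filter fun w => totalDegree E w < t).biUnion (outNbrs E) with hO₂
    -- The pairs joined by two edges, and those joined by a path through a pair in `S'`.
    set S₂ := (E.filter fun e => totalDegree E e.2 < t).biUnion
      (fun e => (outNbrs E e.2).image (Prod.mk e.1)) with hS₂
    set S₃ := (S'.filter fun p => totalDegree E p.1 < t ∧ totalDegree E p.2 < t).biUnion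
      (fun p => inNbrs E p.1 ×ˢ outNbrs E p.2) with hS₃
    have cI₁ : I₁.card ≤ _ := Finset.card_image_le
    have cO₁ : O₁.card ≤ _ := Finset.card_image_le
    have cI₂ : I₂.card ≤ I'.card * t := by
      refine (Finset.card_biUnion_le_card_mul _ _ t fun w hw =>
        (card_inNbrs_le E w).trans (Finset.mem_filter.1 hw).2.le).trans ?_
      exact Nat.mul_le_mul_right _ (Finset.card_filter_le _ _)
    have cO₂ : O₂.card ≤ O'.card * t := by
      refine (Finset.card_biUnion_le_card_mul _ _ t fun w hw =>
        (card_outNbrs_le E w).trans (Finset.mem_filter.1 hw).2.le).trans ?_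
      exact Nat.mul_le_mul_right _ (Finset.card_filter_le _ _)
    have cS₂ : S₂.card ≤ E.card * t := by
      refine (Finset.card_biUnion_le_card_mul _ _ t fun e he => Finset.card_image_le.trans <|
        (card_outNbrs_le E e.2).trans (Finset.mem_filter.1 he).2.le).trans ?_
      exact Nat.mul_le_mul_right _ (Finset.card_filter_le _ _)
    have cS₃ : S₃.card ≤ S'.card * (t * t) := by
      refine (Finset.card_biUnion_le_card_mul _ _ (t * t) fun p hp => ?_).trans ?_
      · have := (Finset.mem_filter.1 hp).2
        rw [Finset.card_product]
        exact Nat.mul_le_mul ((card_inNbrs_le E _).trans this.1.le)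
          ((card_outNbrs_le E _).trans this.2.le)
      · exact Nat.mul_le_mul_right _ (Finset.card_filter_le _ _)
    refine ⟨y, H ∪ B', I₁ ∪ I₂, O₁ ∪ O₂, E ∪ S₂ ∪ S₃, hrr'.trans hy1, ?_, ?_, ?_, ?_, ?_, ?_⟩
    · refine (hy2.trans ?_).trans htop
      exact Nat.le_mul_of_pos_left _ (by positivity)
    · have h1 : H.card * (2 * (r * y)) ≤ n := by
        refine Nat.le_of_mul_le_mul_left ?_ (show 0 < 2 * r by omega)
        calc 2 * r * (H.card * (2 * (r * y))) = H.card * (4 * r ^ 2 * y) := by ring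
          _ ≤ H.card * T := Nat.mul_le_mul_left _ (Nat.mul_le_mul_left _ hy2)
          _ ≤ 2 * (r * n) := hHcard.trans (Nat.mul_le_mul_left _ hcard)
          _ = 2 * r * n := by ring
      have h2 : B'.card * (2 * (r * y)) ≤ n := by
        refine le_trans ?_ hB'
        refine Nat.mul_le_mul_left _ ?_
        rw [← mul_assoc]
        exact Nat.mul_le_mul_right _ ((Nat.le_mul_of_pos_right _ ht).trans h2rt)
      exact mul_le_of_le_add h1 h2 (Finset.card_union_le H B')
    · have h1 : I'.card * t * (2 * r) ≤ n := by
        refine le_trans ?_ hI'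
        rw [mul_assoc]
        exact Nat.mul_le_mul_left _ (by rw [mul_comm t]; exact h2rt)
      refine mul_le_of_le_add (le_trans (Nat.mul_le_mul_right _ ?_) hwin) h1
        ((Finset.card_union_le I₁ I₂).trans (add_le_add cI₁ cI₂))
      exact Nat.le_add_right _ _
    · have h1 : O'.card * t * (2 * r) ≤ n := by
        refine le_trans ?_ hO'
        rw [mul_assoc]
        exact Nat.mul_le_mul_left _ (by rw [mul_comm t]; exact h2rt)
      refine mul_le_of_le_add (le_trans (Nat.mul_le_mul_right _ ?_) hwin) h1
        ((Finset.card_union_le O₁ O₂).trans (add_le_add cO₁ cO₂))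
      exact Nat.le_add_left _ _
    · have h0 : (E ∪ S₂ ∪ S₃).card ≤ E.card + E.card * t + S'.card * (t * t) :=
        (Finset.card_union_le _ _).trans
          (add_le_add ((Finset.card_union_le _ _).trans (Nat.add_le_add_left cS₂ _)) cS₃)
      have h1 : S'.card * (t * t) * (2 * r) ≤ n * y := by
        refine le_trans ?_ hS'
        rw [mul_assoc]
        refine Nat.mul_le_mul_left _ ?_
        calc t * t * (2 * r) = r * (2 * t ^ 2) := by ring
          _ ≤ r ^ 2 * (4 * t ^ 2) := Nat.mul_le_mul (Nat.le_self_pow two_ne_zero r)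
              (Nat.mul_le_mul_right _ (by norm_num))
          _ = r' := by rw [hr']; ring
      have h2 : (E.card + E.card * t) * (2 * r) ≤ n * y := by
        calc (E.card + E.card * t) * (2 * r) = E.card * ((1 + t) * (2 * r)) := by ring
          _ ≤ r * n * ((1 + t) * (2 * r)) := Nat.mul_le_mul_right _ hcard
          _ = n * (2 * r ^ 2 * (1 + t)) := by ring
          _ ≤ n * r' := Nat.mul_le_mul_left _ (by
              rw [hr', show 4 * r ^ 2 * t ^ 2 = 2 * r ^ 2 * (2 * t ^ 2) by ring]
              exact Nat.mul_le_mul_left _ (by nlinarith))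
          _ ≤ n * y := Nat.mul_le_mul_left _ hy1
      exact mul_le_of_le_add h2 h1 h0
    · intro u v huv
      have hmono : ∀ w z, AdjAvoiding E' (H ∪ B') w z → AdjAvoiding E' B' w z :=
        fun w z h => ⟨h.1, fun h' => h.2.1 (Finset.mem_union_right _ h'),
          fun h' => h.2.2 (Finset.mem_union_right _ h')⟩
      have hlow : ∀ w, w ∉ H ∪ B' → totalDegree E w < T := fun w hw => by
        by_contra hcon
        exact hw (Finset.mem_union_left _ (hH w (not_lt.1 hcon)))
      obtain ⟨w, huw, hwv⟩ := Relation.TransGen.head'_iff.1 huv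
      rcases hwv.cases_tail with rfl | ⟨z, hwz, hzv⟩
      · exact Or.inr (Or.inr (Finset.mem_union_left _ (Finset.mem_union_left _ huw.1)))
      by_cases hw : t ≤ totalDegree E w
      · exact Or.inl (Finset.mem_union_left _ (Finset.mem_image.2
          ⟨(u, w), Finset.mem_filter.2 ⟨huw.1, hw, hlow w huw.2.2⟩, rfl⟩))
      by_cases hz : t ≤ totalDegree E z
      · exact Or.inr (Or.inl (Finset.mem_union_left _ (Finset.mem_image.2
          ⟨(z, v), Finset.mem_filter.2 ⟨hzv.1, hz, hlow z hzv.2.1⟩, rfl⟩)))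
      rw [not_le] at hw hz
      have hu := hE _ huw.1
      have hv := hE _ hzv.1
      simp only at hu hv
      obtain ⟨hin, -⟩ := reflTransGen_inner (a := a) (b := a + (2 * (j + 1) + 1))
        (fun e he => (hE e he).2.1) hwz (by omega) (by omega)
      rcases Relation.reflTransGen_iff_eq_or_transGen.1 hin with rfl | hin
      · refine Or.inr (Or.inr (Finset.mem_union_left _ (Finset.mem_union_right _ ?_)))
        exact Finset.mem_biUnion.2 ⟨(u, z), Finset.mem_filter.2 ⟨huw.1, hw⟩,
          Finset.mem_image.2 ⟨v, mem_outNbrs.2 hzv.1, rfl⟩⟩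
      rcases hpath w z (Relation.TransGen.mono hmono _ _ hin) with hI | hO | hS
      · exact Or.inl (Finset.mem_union_right _ (Finset.mem_biUnion.2
          ⟨w, Finset.mem_filter.2 ⟨hI, hw⟩, mem_inNbrs.2 huw.1⟩))
      · exact Or.inr (Or.inl (Finset.mem_union_right _ (Finset.mem_biUnion.2
          ⟨z, Finset.mem_filter.2 ⟨hO, hz⟩, mem_outNbrs.2 hzv.1⟩)))
      · exact Or.inr (Or.inr (Finset.mem_union_right _ (Finset.mem_biUnion.2
          ⟨(w, z), Finset.mem_filter.2 ⟨hS, hw, hz⟩,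
            Finset.mem_product.2 ⟨mem_inNbrs.2 huw.1, mem_outNbrs.2 hzv.1⟩⟩)))

end Cut

/-! ### Comparison with the functions `λ_d` -/

/-- The upper inverse of `lam (2 * (k + 1))`: the largest `n` with `lam (2 * (k + 1)) n ≤ v`, which
is `2 ^ v` for `k = 0`, a tower of `v` twos for `k = 1`, and so on. -/
def lamInv : ℕ → ℕ → ℕ
  | 0, v => 2 ^ v
  | k + 1, v => (lamInv k)^[v] 1

theorem lam_le_of_le_lamInv (k : ℕ) : ∀ n v, n ≤ lamInv k v → lam (2 * (k + 1)) n ≤ v := by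
  induction k with
  | zero => intro n v h; exact Nat.clog_le_of_le_pow h
  | succ k ih =>
    intro n v h
    have key : ∀ i N, N ≤ (lamInv k)^[i] 1 → (lam (2 * (k + 1)))^[i] N ≤ 1 := by
      intro i
      induction i with
      | zero => intro N hN; exact hN
      | succ i ihi =>
        intro N hN
        rw [Function.iterate_succ_apply'] at hN
        rw [Function.iterate_succ_apply]
        exact ihi _ (ih _ _ hN)
    exact Nat.sInf_le (key v n h)

theorem lamInv_succ_succ (k v : ℕ) : lamInv (k + 1) (v + 1) = lamInv k (lamInv (k + 1) v) := by
  simp only [lamInv, Function.iterate_succ_apply']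

theorem two_pow_le_lamInv (k : ℕ) : ∀ v, 2 ^ v ≤ lamInv k v := by
  induction k with
  | zero => intro v; exact le_rfl
  | succ k ih =>
    intro v
    induction v with
    | zero => exact le_rfl
    | succ v ihv =>
      rw [lamInv_succ_succ]
      refine le_trans (Nat.pow_le_pow_right two_pos ?_) (ih _)
      exact (Nat.succ_le_of_lt Nat.lt_two_pow_self).trans ihv

theorem lt_lamInv (k v : ℕ) : v < lamInv k v := Nat.lt_two_pow_self.trans_le (two_pow_le_lamInv k v)

theorem lamInv_mono (k : ℕ) : Monotone (lamInv k) := by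
  refine monotone_nat_of_le_succ fun v => ?_
  cases k with
  | zero => exact Nat.pow_le_pow_right two_pos v.le_succ
  | succ k => rw [lamInv_succ_succ]; exact (lt_lamInv k _).le

theorem lamInv_one_two (k : ℕ) : lamInv k 1 = 2 ∧ lamInv k 2 = 4 := by
  induction k with
  | zero => simp [lamInv]
  | succ k ih => simp [lamInv, ih.1, ih.2]

/-- Since `lamInv k` maps `1` to `2` and `2` to `4`, two of the six applications of `lamInv k` to `1`
only lead to `4`. -/
theorem lamInv_succ_six (k : ℕ) : lamInv (k + 1) 6 = (lamInv k)^[3] (lamInv k 4) := by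
  simp [lamInv, (lamInv_one_two k).1, (lamInv_one_two k).2]

theorem le_lamInv_four (k : ℕ) : k ≤ lamInv k 4 := by
  induction k with
  | zero => exact Nat.zero_le _
  | succ k ih =>
    have h : lamInv (k + 1) 4 = lamInv k (lamInv k 4) := by
      simp [lamInv, (lamInv_one_two k).1, (lamInv_one_two k).2]
    rw [h]
    exact ih.trans_lt (lt_lamInv k _)

theorem mul_pow_seven_le_two_pow (t : ℕ) (ht : 64 ≤ t) : 64 * t ^ 7 ≤ 2 ^ t := by
  induction t, ht using Nat.le_induction with
  | base => norm_num
  | succ t ht ih =>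
    have h : 64 ^ 7 * (t + 1) ^ 7 ≤ 64 ^ 7 * (2 * t ^ 7) := by
      calc 64 ^ 7 * (t + 1) ^ 7 = (64 * (t + 1)) ^ 7 := (mul_pow _ _ _).symm
        _ ≤ (65 * t) ^ 7 := Nat.pow_le_pow_left (by omega) _
        _ = 65 ^ 7 * t ^ 7 := mul_pow _ _ _
        _ ≤ 64 ^ 7 * 2 * t ^ 7 := Nat.mul_le_mul_right _ (by norm_num)
        _ = 64 ^ 7 * (2 * t ^ 7) := mul_assoc _ _ _
    have h := Nat.le_of_mul_le_mul_left h (by norm_num)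
    rw [pow_succ 2]
    omega

theorem pow_le_lamInv {a b k t : ℕ} (ha : a ≤ 64) (hb : b ≤ 7) (ht : 64 ≤ t) :
    a * t ^ b ≤ lamInv k t :=
  (Nat.mul_le_mul ha (Nat.pow_le_pow_right (by omega) hb)).trans
    ((mul_pow_seven_le_two_pow t ht).trans (two_pow_le_lamInv k t))

theorem le_iterate_lamInv (k i t : ℕ) : t + i ≤ (lamInv k)^[i] t := by
  induction i with
  | zero => exact le_rfl
  | succ i ih =>
    rw [Function.iterate_succ_apply']
    exact Nat.succ_le_of_lt (ih.trans_lt (lt_lamInv k _))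

/-- Both sides are doubly or triply exponential in `r`: the recursion for `cutBound 1` takes `t` to
a polynomial in `r` and `t`, which is at most `t ^ 11` for `r ≤ t`. -/
theorem cutBound_one_le (r : ℕ) (hr : 64 ≤ r) : cutBound 1 r ≤ (lamInv 0)^[3] r := by
  have key : ∀ i, (fun t => 4 * r ^ 2 * cutBound 0 (4 * r ^ 2 * t ^ 2))^[i] r ≤ r ^ 11 ^ i ∧
      r ≤ (fun t => 4 * r ^ 2 * cutBound 0 (4 * r ^ 2 * t ^ 2))^[i] r := by
    intro i
    induction i with
    | zero => simp
    | succ i ih =>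
      rw [Function.iterate_succ_apply']
      set t := (fun t => 4 * r ^ 2 * cutBound 0 (4 * r ^ 2 * t ^ 2))^[i] r
      have h1 : 4 * r ^ 2 * (4 * r ^ 2 * t ^ 2) ^ 2 = 64 * r ^ 6 * t ^ 4 := by ring
      simp only [cutBound, h1]
      constructor
      · calc 64 * r ^ 6 * t ^ 4 ≤ t * t ^ 6 * t ^ 4 := by
              gcongr
              · exact hr.trans ih.2
              · exact ih.2
          _ = t ^ 11 := by ring
          _ ≤ (r ^ 11 ^ i) ^ 11 := Nat.pow_le_pow_left ih.1 _
          _ = r ^ 11 ^ (i + 1) := by rw [← pow_mul, pow_succ]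
      · have : 1 ≤ t := by omega
        calc r ≤ 64 * r ^ 6 * 1 ^ 4 := by
              have := Nat.le_self_pow (n := 6) (by norm_num) r
              omega
          _ ≤ 64 * r ^ 6 * t ^ 4 := by gcongr
  refine (key (4 * r ^ 2)).1.trans ?_
  change _ ≤ 2 ^ 2 ^ 2 ^ r
  calc r ^ 11 ^ (4 * r ^ 2) ≤ (2 ^ r) ^ (2 ^ 4) ^ (4 * r ^ 2) := by
        refine (Nat.pow_le_pow_left Nat.lt_two_pow_self.le _).trans ?_
        exact Nat.pow_le_pow_right (by positivity) (Nat.pow_le_pow_left (by norm_num) _)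
    _ = 2 ^ (r * 2 ^ (16 * r ^ 2)) := by rw [← pow_mul, ← pow_mul]; ring_nf
    _ ≤ 2 ^ 2 ^ 2 ^ r := by
        refine Nat.pow_le_pow_right two_pos ?_
        calc r * 2 ^ (16 * r ^ 2) ≤ 2 ^ r * 2 ^ (16 * r ^ 2) :=
              Nat.mul_le_mul_right _ Nat.lt_two_pow_self.le
          _ = 2 ^ (r + 16 * r ^ 2) := (pow_add _ _ _).symm
          _ ≤ 2 ^ 2 ^ r := by
              refine Nat.pow_le_pow_right two_pos ?_
              refine le_trans ?_ (pow_le_lamInv (k := 0) (a := 17) (b := 2) (by norm_num)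
                (by norm_num) hr)
              nlinarith

/-- The bound `cutBound (k + 1)` is at most three applications of `lamInv k`, uniformly in `k`:
the polynomial factors in its recursion are absorbed by additional applications of `lamInv`. -/
theorem cutBound_le (k : ℕ) : ∀ r, 64 ≤ r → cutBound (k + 1) r ≤ (lamInv k)^[3] r := by
  induction k with
  | zero => exact cutBound_one_le
  | succ k ih =>
    intro r hr
    have step : ∀ t, r ≤ t →
        4 * r ^ 2 * cutBound (k + 1) (4 * r ^ 2 * t ^ 2) ≤ (lamInv k)^[5] t := by
      intro t ht
      have h1 : 4 * r ^ 2 * t ^ 2 ≤ lamInv k t := by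
        refine le_trans ?_ (pow_le_lamInv (a := 4) (b := 4) (by norm_num) (by norm_num)
          (hr.trans ht))
        calc 4 * r ^ 2 * t ^ 2 ≤ 4 * t ^ 2 * t ^ 2 := by gcongr
          _ = 4 * t ^ 4 := by ring
      have h2 : 64 ≤ 4 * r ^ 2 * t ^ 2 := by
        have : 1 ≤ t ^ 2 := Nat.one_le_pow _ _ (by omega)
        nlinarith
      have h3 := (ih _ h2).trans ((lamInv_mono k).iterate 3 h1)
      rw [← Function.iterate_succ_apply] at h3
      have h4 := le_iterate_lamInv k 4 t
      calc 4 * r ^ 2 * cutBound (k + 1) (4 * r ^ 2 * t ^ 2)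
          ≤ 4 * ((lamInv k)^[4] t) ^ 2 * (lamInv k)^[4] t := by
            gcongr
            omega
        _ = 4 * ((lamInv k)^[4] t) ^ 3 := by ring
        _ ≤ lamInv k ((lamInv k)^[4] t) :=
            pow_le_lamInv (by norm_num) (by norm_num) (by omega)
        _ = (lamInv k)^[5] t := (Function.iterate_succ_apply' _ _ _).symm
    have hge : ∀ i, r ≤ (fun t => 4 * r ^ 2 * cutBound (k + 1) (4 * r ^ 2 * t ^ 2))^[i] r :=
      le_iterate_of_le fun t ht => by
        have ht1 : 1 ≤ t := by omega
        exact le_four_mul_sq_mul (by omega) ht1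
          (le_cutBound _ _ (Nat.succ_le_of_lt (by positivity)))
    have hiter : ∀ i, (fun t => 4 * r ^ 2 * cutBound (k + 1) (4 * r ^ 2 * t ^ 2))^[i] r ≤
        (lamInv k)^[5 * i] r := by
      intro i
      induction i with
      | zero => exact le_rfl
      | succ i ihi =>
        rw [Function.iterate_succ_apply', mul_add, mul_one, add_comm (5 * i),
          Function.iterate_add_apply]
        exact (step _ (hge i)).trans ((lamInv_mono k).iterate 5 ihi)
    calc cutBound (k + 1 + 1) r ≤ (lamInv k)^[5 * (4 * r ^ 2)] r := hiter _
      _ ≤ (lamInv k)^[5 * (4 * r ^ 2)] ((lamInv k)^[r] 1) :=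
          (lamInv_mono k).iterate _ (lt_lamInv (k + 1) r).le
      _ = lamInv (k + 1) (5 * (4 * r ^ 2) + r) := by
          rw [← Function.iterate_add_apply]; rfl
      _ ≤ lamInv (k + 1) (lamInv (k + 1) r) := by
          refine lamInv_mono _ (le_trans ?_ (pow_le_lamInv (a := 21) (b := 2) (by norm_num)
            (by norm_num) hr))
          nlinarith
      _ ≤ (lamInv (k + 1))^[3] r := (lt_lamInv _ _).le

/-- This is where the threshold `6` in the definition of `α` is used: `lamInv (k + 1) 6` consists of
four applications of `lamInv k` to `4`. The innermost one exceeds the constant `r` for large `k`,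
and the other three bound `cutBound (k + 1)`. -/
theorem cutBound_lt_of_lam {r k n : ℕ} (hr : 64 ≤ r) (hk : r ≤ k)
    (h : 6 < lam (2 * (k + 2)) n) : cutBound (k + 1) r < n := by
  have h1 : lamInv (k + 1) 6 < n := by
    by_contra hcon
    exact absurd (lam_le_of_le_lamInv (k + 1) n 6 (not_lt.1 hcon)) (not_le.2 h)
  refine lt_of_le_of_lt ((cutBound_le k r hr).trans ?_) h1
  rw [lamInv_succ_six]
  exact (lamInv_mono k).iterate 3 (hk.trans (le_lamInv_four k))

/-! ### Circuits with few wires -/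

namespace Circuit

variable {n m : ℕ} (C : Circuit n m)

/-- There is a directed path from some input to the vertex `v`. -/
def FromInput (v : Fin n ⊕ C.Gate) : Prop :=
  ∃ i, Relation.ReflTransGen (fun u w => (u, w) ∈ C.wires) (Sum.inl i) v

/-- There is a directed path from the vertex `v` to some output. -/
def ToOutput (v : Fin n ⊕ C.Gate) : Prop :=
  ∃ j, Relation.ReflTransGen (fun u w => (u, w) ∈ C.wires) v (C.output j)

/-- The lengths of the directed paths from an input to the vertex `v`. -/
def lengthsTo (v : Fin n ⊕ C.Gate) : Set ℕ :=
  {k | ∃ p : RelSeries C.wires, p.length = k ∧ (∃ i, p.head = Sum.inl i) ∧ p.last = v}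

/-- The level of a vertex is the length of a longest directed path from an input to it. -/
noncomputable def level (v : Fin n ⊕ C.Gate) : ℕ := sSup (C.lengthsTo v)

variable {C}

theorem lengthsTo_succ {u v : Fin n ⊕ C.Gate} (h : (u, v) ∈ C.wires) {k : ℕ}
    (hk : k ∈ C.lengthsTo u) : k + 1 ∈ C.lengthsTo v := by
  obtain ⟨p, rfl, ⟨i, hi⟩, hp⟩ := hk
  refine ⟨p.snoc v (by rw [hp]; exact h), by simp, ⟨i, by simpa using hi⟩, by simp⟩

theorem le_depth_of_mem_lengthsTo {v : Fin n ⊕ C.Gate} (hv : C.ToOutput v) {k : ℕ}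
    (hk : k ∈ C.lengthsTo v) : k ≤ C.depth := by
  obtain ⟨j, hj⟩ := hv
  induction hj using Relation.ReflTransGen.head_induction_on generalizing k with
  | refl =>
    obtain ⟨p, hp, hi, hl⟩ := hk
    exact le_csSup C.bddAbove_pathLengths ⟨p, hp, hi, j, hl⟩
  | head h _ ih => exact (Nat.le_succ k).trans (ih (lengthsTo_succ h hk))

theorem level_le_depth {v : Fin n ⊕ C.Gate} (hv : C.ToOutput v) : C.level v ≤ C.depth :=
  csSup_le' fun _ hk => le_depth_of_mem_lengthsTo hv hk

theorem lengthsTo_nonempty {v : Fin n ⊕ C.Gate} (hv : C.FromInput v) :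
    (C.lengthsTo v).Nonempty := by
  obtain ⟨i, hi⟩ := hv
  induction hi with
  | refl => exact ⟨0, RelSeries.singleton C.wires (Sum.inl i), rfl, ⟨i, rfl⟩, rfl⟩
  | tail _ h ih =>
    obtain ⟨k, hk⟩ := ih
    exact ⟨k + 1, lengthsTo_succ h hk⟩

theorem ToOutput.of_wire {u v : Fin n ⊕ C.Gate} (h : (u, v) ∈ C.wires) (hv : C.ToOutput v) :
    C.ToOutput u :=
  hv.imp fun _ hj => hj.head h

theorem level_lt_level {u v : Fin n ⊕ C.Gate} (h : (u, v) ∈ C.wires) (hu : C.FromInput u)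
    (hv : C.ToOutput v) : C.level u < C.level v := by
  have hmem : C.level u ∈ C.lengthsTo u :=
    Nat.sSup_mem (lengthsTo_nonempty hu)
      ⟨C.depth, fun _ hk => le_depth_of_mem_lengthsTo (hv.of_wire h) hk⟩
  exact le_csSup (s := C.lengthsTo v) ⟨C.depth, fun _ hk => le_depth_of_mem_lengthsTo hv hk⟩
    (lengthsTo_succ h hmem)

variable (C) in
open Classical in
/-- The wires that lie on a directed path from an input to an output. -/
noncomputable def pathWires : Finset ((Fin n ⊕ C.Gate) × (Fin n ⊕ C.Gate)) :=
  (Finset.univ.biUnion fun v : C.Gate => (C.preds v).image fun u => (u, Sum.inr v)).filter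
    fun e => C.FromInput e.1 ∧ C.ToOutput e.2

theorem mem_pathWires {u v : Fin n ⊕ C.Gate} :
    (u, v) ∈ C.pathWires ↔ (u, v) ∈ C.wires ∧ C.FromInput u ∧ C.ToOutput v := by
  classical
  simp only [pathWires, wires, Finset.mem_filter, Finset.mem_biUnion, Finset.mem_univ, true_and,
    Finset.mem_image, Prod.mk.injEq, Set.mem_ofPred_eq]
  refine and_congr_left fun _ => exists_congr fun w => ?_
  constructor
  · rintro ⟨a, ha, rfl, rfl⟩
    exact ⟨rfl, ha⟩
  · rintro ⟨rfl, ha⟩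
    exact ⟨u, ha, rfl, rfl⟩

variable (C) in
theorem card_pathWires_le : C.pathWires.card ≤ C.size := by
  classical
  refine (Finset.card_filter_le _ _).trans (Finset.card_biUnion_le.trans ?_)
  exact Finset.sum_le_sum fun v _ => Finset.card_image_le

/-- If the values on two messages agree on the vertices in `B`, then a difference at a vertex is
caused by a path avoiding `B` from an input bit where the two messages differ. -/
theorem exists_path_of_value_ne {x x' : Fin n → Bool} {B : Finset (Fin n ⊕ C.Gate)}
    (hB : ∀ b ∈ B, C.value x b = C.value x' b) (v : Fin n ⊕ C.Gate) (hv : C.ToOutput v)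
    (hne : C.value x v ≠ C.value x' v) :
    ∃ i, x i ≠ x' i ∧ Relation.ReflTransGen (AdjAvoiding C.pathWires B) (Sum.inl i) v := by
  suffices H : ∀ v, C.ToOutput v → C.value x v ≠ C.value x' v → C.FromInput v ∧
      ∃ i, x i ≠ x' i ∧ Relation.ReflTransGen (AdjAvoiding C.pathWires B) (Sum.inl i) v from
    (H v hv hne).2
  clear! v
  rintro (i | v) hv hne
  · exact ⟨⟨i, .refl⟩, i, hne, .refl⟩
  induction v using C.acyclic.induction with
  | _ v ih =>
  obtain ⟨u, hu, hne'⟩ : ∃ u ∈ C.preds v, C.value x u ≠ C.value x' u := by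
    by_contra! hcon
    refine hne ?_
    rw [value_inr, value_inr]
    congr 1
    funext u
    exact hcon u u.2
  have hwire : (u, Sum.inr v) ∈ C.wires := ⟨v, rfl, hu⟩
  have hu' : C.FromInput u ∧ ∃ i, x i ≠ x' i ∧
      Relation.ReflTransGen (AdjAvoiding C.pathWires B) (Sum.inl i) u := by
    rcases u with i | w
    · exact ⟨⟨i, .refl⟩, i, hne', .refl⟩
    · exact ih w hu (hv.of_wire hwire) hne'
  obtain ⟨⟨i₀, h0⟩, i, hi, hpath⟩ := hu'
  refine ⟨⟨i₀, h0.tail hwire⟩, i, hi, hpath.tail ⟨mem_pathWires.2 ⟨hwire, ⟨i₀, h0⟩, hv⟩, ?_, ?_⟩⟩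
  · exact fun h => hne' (hB _ h)
  · exact fun h => hne (hB _ h)

open Finset in
/-- A circuit with at most `r * n` wires and depth at most `2 * j + 1` maps two distinct messages to
words that differ in at most `11 * n / r` positions, once `n` exceeds `cutBound j r`: some
`#B + 1` inputs reach only few outputs without passing through the cut `B`, and two settings of
these inputs give the same values on `B`. -/
theorem exists_close_codewords (C : Circuit n m) {j r : ℕ} (hr : 8 ≤ r) (hn : cutBound j r ≤ n)
    (hsize : C.size ≤ r * n) (hdepth : C.depth ≤ 2 * j + 1) :
    ∃ x x' : Fin n → Bool, x ≠ x' ∧ hammingDist (C.eval x) (C.eval x') * r ≤ 11 * n := by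
  classical
  obtain ⟨y, B, I, O, S, hry, hy, hB, hI, hO, hS, hpath⟩ :=
    exists_sparse_cut j r n 0 C.level C.pathWires (by omega)
      (fun e he => by
        obtain ⟨h1, h2, h3⟩ := mem_pathWires.1 he
        have := level_le_depth h3
        exact ⟨Nat.zero_le _, level_lt_level h1 h2 h3, by omega⟩)
      (C.card_pathWires_le.trans hsize)
  have hyn : y ≤ n := hy.trans hn
  -- By Markov's inequality, most inputs are connected to few vertices.
  set bad₁ : Finset (Fin n) := {i | Sum.inl i ∈ I} with hbad₁
  set bad₂ : Finset (Fin n) := {i | 4 * y < #{e ∈ S | e.1 = Sum.inl i} * r} with hbad₂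
  have cbad₁ : #bad₁ * r ≤ n := by
    refine (Nat.mul_le_mul_right r ?_).trans hI
    refine card_le_card_of_injOn Sum.inl (fun i hi => ?_) Sum.inl_injective.injOn
    simpa [hbad₁] using hi
  have cbad₂ : #bad₂ * 4 ≤ n := by
    refine Nat.le_of_mul_le_mul_right ?_ (show 0 < y by omega)
    calc #bad₂ * 4 * y = #bad₂ • (4 * y) := by rw [smul_eq_mul]; ring
      _ ≤ ∑ i ∈ bad₂, #{e ∈ S | e.1 = Sum.inl i} * r :=
          card_nsmul_le_sum _ _ _ fun i hi => (by simpa [hbad₂] using hi : _ < _).le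
      _ = (∑ v ∈ bad₂.map Function.Embedding.inl, #{e ∈ S | e.1 = v}) * r := by
          rw [sum_map, sum_mul]; rfl
      _ ≤ #S * r := Nat.mul_le_mul_right _ (sum_card_fiber_le _ S Prod.fst)
      _ ≤ n * y := hS
  have hgood : #B + 1 ≤ #(bad₁ ∪ bad₂)ᶜ := by
    have h1 := card_union_le bad₁ bad₂
    rw [card_compl, Fintype.card_fin]
    have h2 : #B * 64 ≤ n := (Nat.mul_le_mul_left _ (by nlinarith)).trans hB
    have h3 : #bad₁ * 8 ≤ n := (Nat.mul_le_mul_left _ hr).trans cbad₁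
    omega
  obtain ⟨X, hXsub, hX⟩ := exists_subset_card_eq hgood
  have hXgood : ∀ i ∈ X, Sum.inl i ∉ I ∧ #{e ∈ S | e.1 = Sum.inl i} * r ≤ 4 * y := fun i hi => by
    simpa [hbad₁, hbad₂] using hXsub hi
  -- Messages supported on `X`; there are more of them than value patterns on `B`.
  let ext : (X → Bool) → Fin n → Bool := fun z i => if h : i ∈ X then z ⟨i, h⟩ else false
  obtain ⟨z, z', hne, hzz⟩ := Fintype.exists_ne_map_eq_of_card_lt
    (fun (z : X → Bool) (b : B) => C.value (ext z) b) (by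
      simp [hX, pow_succ])
  refine ⟨ext z, ext z', fun h => hne ?_, ?_⟩
  · funext i
    simpa [ext] using congrFun h i
  set L := X.biUnion fun i => ({e ∈ S | e.1 = Sum.inl i}).image Prod.snd with hL
  have hsub : (({k | C.eval (ext z) k ≠ C.eval (ext z') k} : Finset (Fin m)).map C.output) ⊆
      X.map Function.Embedding.inl ∪ O ∪ L := by
    intro v hv
    obtain ⟨k, hk, rfl⟩ := mem_map.1 hv
    obtain ⟨i, hi, hreach⟩ := exists_path_of_value_ne (fun b hb => congrFun hzz ⟨b, hb⟩)
      (C.output k) ⟨k, .refl⟩ (mem_filter.1 hk).2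
    have hiX : i ∈ X := by
      by_contra hcon
      simp [ext, hcon] at hi
    rcases Relation.reflTransGen_iff_eq_or_transGen.1 hreach with h | h
    · exact mem_union_left _ (mem_union_left _ (mem_map.2 ⟨i, hiX, h.symm⟩))
    rcases hpath _ _ h with h | h | h
    · exact absurd h (hXgood i hiX).1
    · exact mem_union_left _ (mem_union_right _ h)
    · exact mem_union_right _ (mem_biUnion.2
        ⟨i, hiX, mem_image.2 ⟨_, mem_filter.2 ⟨h, rfl⟩, rfl⟩⟩)
  have hcard := card_le_card hsub
  rw [card_map] at hcard
  have hcard' : hammingDist (C.eval (ext z)) (C.eval (ext z')) ≤ #B + 1 + #O + #L := by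
    refine hcard.trans ((card_union_le _ _).trans (Nat.add_le_add_right
      ((card_union_le _ _).trans_eq ?_) _))
    rw [card_map, hX]
  have hLcard : #L * r ≤ 8 * n := by
    calc #L * r ≤ (∑ i ∈ X, #{e ∈ S | e.1 = Sum.inl i}) * r :=
          Nat.mul_le_mul_right _ (card_biUnion_le.trans (sum_le_sum fun i _ => card_image_le))
      _ = ∑ i ∈ X, #{e ∈ S | e.1 = Sum.inl i} * r := sum_mul ..
      _ ≤ #X • (4 * y) := sum_le_card_nsmul _ _ _ fun i hi => (hXgood i hi).2
      _ = 4 * (#B * y) + 4 * y := by rw [hX, smul_eq_mul]; ring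
      _ ≤ 8 * n := by
          have : #B * y ≤ n := (Nat.mul_le_mul_left _
            (Nat.le_mul_of_pos_left y (by omega))).trans hB
          omega
  have hBr : #B * r ≤ n :=
    (Nat.mul_le_mul_left _ (Nat.le_mul_of_pos_right r (by omega))).trans hB
  calc hammingDist (C.eval (ext z)) (C.eval (ext z')) * r
      ≤ (#B + 1 + #O + #L) * r := Nat.mul_le_mul_right _ hcard'
    _ = #B * r + r + #O * r + #L * r := by ring
    _ ≤ 11 * n := by omega

end Circuit

/-! ### The depth lower bound -/

/-- If `α(n) - 2` exceeds `d`, then `d ≤ 2 * k + 1` for some `k` with `6 < λ_{2 (k + 1)}(n)`. -/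
theorem exists_lam_of_lt_inverseAckermann {n d : ℕ} (h : d + 2 < inverseAckermann n) :
    ∃ k, d ≤ 2 * k + 1 ∧ 6 < lam (2 * (k + 1)) n := by
  have hne : {d : ℕ | 0 < d ∧ Even d ∧ lam d n ≤ 6}.Nonempty :=
    Nat.nonempty_of_pos_sInf (by unfold inverseAckermann at h; omega)
  obtain ⟨-, ⟨q, hq⟩, -⟩ := Nat.sInf_mem hne
  change inverseAckermann n = q + q at hq
  obtain ⟨k, rfl⟩ : ∃ k, q = k + 2 := ⟨q - 2, by omega⟩
  refine ⟨k, by omega, ?_⟩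
  by_contra hcon
  have h1 : inverseAckermann n ≤ 2 * (k + 1) :=
    Nat.sInf_le ⟨by omega, even_two_mul _, not_lt.1 hcon⟩
  omega

theorem theorem2 (ρ δ c : ℝ) (hρ : 0 < ρ ∧ ρ < 1) (hδ : 0 < δ ∧ δ < 1 / 2) (hc : 0 < c) :
    ∃ N : ℕ, ∀ n : ℕ, N ≤ n → ∀ C : Circuit n ⌊(n : ℝ) / ρ⌋₊,
      (C.size : ℝ) ≤ c * n → EncodesRelDist δ C.eval →
        (inverseAckermann n : ℤ) - 2 ≤ (C.depth : ℤ) := by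
  obtain ⟨s, hs⟩ := exists_nat_gt (max c (11 / δ))
  obtain ⟨hsc, hsδ⟩ := max_lt_iff.1 hs
  set r := max 64 s with hr
  have hsr : (s : ℝ) ≤ r := by exact_mod_cast le_max_right 64 s
  have h64 : 64 ≤ r := le_max_left _ _
  -- This threshold serves the depths up to `2 * r + 3`. At greater depth `n` is large enough because
  -- `α(n)` is: then `6 < λ_{2 (k + 1)}(n)` with `r < k`.
  refine ⟨cutBound (r + 1) r, fun n hn C hsize henc => ?_⟩
  by_contra hcon
  obtain ⟨k, hk, hlam⟩ := exists_lam_of_lt_inverseAckermann (n := n) (d := C.depth) (by omega)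
  obtain ⟨j, hj, hcut⟩ : ∃ j, C.depth ≤ 2 * j + 1 ∧ cutBound j r ≤ n := by
    rcases le_or_gt k (r + 1) with hkr | hkr
    · exact ⟨r + 1, by omega, hn⟩
    · obtain ⟨l, rfl⟩ : ∃ l, k = l + 1 := ⟨k - 1, by omega⟩
      exact ⟨l + 1, hk, (cutBound_lt_of_lam h64 (by omega) hlam).le⟩
  have hsize' : C.size ≤ r * n := by
    have : (C.size : ℝ) ≤ r * n :=
      hsize.trans (mul_le_mul_of_nonneg_right (hsc.le.trans hsr) n.cast_nonneg)
    exact_mod_cast this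
  obtain ⟨x, x', hne, hdist⟩ := C.exists_close_codewords (by omega) hcut hsize' hj
  have hnpos : 0 < n := (by omega : 0 < r).trans_le ((le_cutBound _ _ (by omega)).trans hcut)
  have hm : n ≤ ⌊(n : ℝ) / ρ⌋₊ :=
    Nat.le_floor (le_div_self n.cast_nonneg hρ.1 hρ.2.le)
  have h1 : δ * n ≤ hammingDist (C.eval x) (C.eval x') :=
    (mul_le_mul_of_nonneg_left (by exact_mod_cast hm) hδ.1.le).trans (henc x x' hne)
  have h2 : (hammingDist (C.eval x) (C.eval x') : ℝ) * r ≤ 11 * n := by exact_mod_cast hdist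
  have h3 : 11 < r * δ := (div_lt_iff₀ hδ.1).1 (hsδ.trans_le hsr)
  have hnR : (0 : ℝ) < n := by exact_mod_cast hnpos
  have hrR : (0 : ℝ) ≤ r := r.cast_nonneg
  nlinarith [mul_le_mul_of_nonneg_right h1 hrR, mul_lt_mul_of_pos_right h3 hnR]
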